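/- \textbf{Theorem.} Let $m,n\ge 1$, let $D>0$, and let $X=(x_{jk})$ be an $m\times n$ random matrix whose entries $x_{jk}$ ($1\le j\le m$, $1\le k\le n$) are independent complex random variables. Suppose that each $x_{jk}$ satisfies one of the following two conditions: either $x_{jk}$ is (almost surely) supported in a subset of $\mathbb{C}$ of diameter at most $D$; or $x_{jk}=w_{jk}(\alpha_{jk}+i\beta_{jk})$, where $w_{jk}\in\mathbb{C}$ is a constant with $|w_{jk}|\le 1$, and $\alpha_{jk},\beta_{jk}$ are independent real random variables, each (almost surely) supported in an interval of length at most $D$. For an $m\times n$ complex matrix $A$ let $s_1(A)\ge s_2(A)\ge\cdots\ge s_{\min\{m,n\}}(A)\ge 0$ denote its singular values, counted with multiplicity; that is, $s_k(A)$ is the $k$-th largest eigenvalue of $(A^*A)^{1/2}$. Then, for every median $\mathbb{M}s_1(X)$ of $s_1(X)$ and every $t>0$, $$\mathbb{P}\bigl[\,|s_1(X)-\mathbb{M}s_1(X)|\ge t\,\bigr]\le 4\,e^{-t^2/(4D^2)}.$$ Furthermore, for each $2\le k\le\min\{m,n\}$ there exists $M_k\in\mathbb{R}$ such that, for all $t>0$,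 $$\mathbb{P}\bigl[\,|s_k(X)-M_k|\ge t\,\bigr]\le 8\exp\left[-\left(\frac{t}{2(\sqrt{k}+\sqrt{k-1})D}\right)^2\right]\le 8\exp\left[-\frac{t^2}{16kD^2}\right].$$ -/

import Mathlib

open MeasureTheory ProbabilityTheory

/-- `s_k(A)` for `k = 1, 2, …`: the `k`-th largest singular value, counted with multiplicity, of the
complex matrix `A`, that is, the `k`-th largest eigenvalue of `(A* A)^{1/2}`, where `A` acts between
the Euclidean spaces `ℂⁿ` and `ℂᵐ`. (Mathlib numbers singular values from `0`.) -/
noncomputable def matrixSingularValue {m n : ℕ} (A : Matrix (Fin m) (Fin n) ℂ) (k : ℕ) : ℝ :=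
  (Matrix.toEuclideanLin A).singularValues (k - 1)

/-- `M` is a median of the real random variable `Y`. -/
def IsMedian {Ω : Type*} [MeasurableSpace Ω] (Y : Ω → ℝ) (μ : Measure Ω) (M : ℝ) : Prop :=
  1 / 2 ≤ μ.real {ω | Y ω ≤ M} ∧ 1 / 2 ≤ μ.real {ω | M ≤ Y ω}

/-- The complex random variable `x` is (almost surely) supported in a set of diameter at most `D`.
The extended diameter is used, so that an unbounded set has infinite diameter. -/
def SupportedInDiam {Ω : Type*} [MeasurableSpace Ω] (x : Ω → ℂ) (μ : Measure Ω) (D : ℝ) : Prop :=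
  ∃ S : Set ℂ, Metric.ediam S ≤ ENNReal.ofReal D ∧ ∀ᵐ ω ∂μ, x ω ∈ S

/-- The real random variable `y` is (almost surely) supported in an interval of length at most
`D`. -/
def SupportedInInterval {Ω : Type*} [MeasurableSpace Ω] (y : Ω → ℝ) (μ : Measure Ω) (D : ℝ) :
    Prop :=
  ∃ a b : ℝ, b - a ≤ D ∧ ∀ᵐ ω ∂μ, y ω ∈ Set.Icc a b

/-- The boundedness condition on an entry: either `x` is supported in a set of diameter at most `D`,
or `x = w (α + i β)` with a constant `w`, `|w| ≤ 1`, and independent real random variables `α`, `β`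
each supported in an interval of length at most `D`. -/
def BoundedEntry {Ω : Type*} [MeasurableSpace Ω] (x : Ω → ℂ) (μ : Measure Ω) (D : ℝ) : Prop :=
  SupportedInDiam x μ D ∨
  ∃ (w : ℂ) (α β : Ω → ℝ), ‖w‖ ≤ 1 ∧ Measurable α ∧ Measurable β ∧ IndepFun α β μ ∧
    SupportedInInterval α μ D ∧ SupportedInInterval β μ D ∧
    ∀ᵐ ω ∂μ, x ω = w * ((α ω : ℂ) + Complex.I * (β ω : ℂ))

/-! The sum of the `k` largest singular values (the Ky Fan norm) is a maximum of real parts of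
linear functionals of the matrix. It is therefore convex, and Cauchy–Schwarz makes it `√k`-Lipschitz
for the Frobenius norm (`convexOn_kyFan`, `lipschitzWith_kyFan`). Convex Lipschitz functions of
independent bounded variables concentrate around their medians.

That concentration comes from Maurey's property (τ) with cost `‖x - y‖ ^ 2 / (4 * D ^ 2)`. It holds
for one entry supported in a set of diameter at most `D` (`maureyProperty_of_ediam_le`). It passes
to products and their images under linear contractions (`MaureyProperty.map_prod`), which covers
both `w (α + i β)` and the whole matrix. It yields Gaussian tails
(`MaureyProperty.measureReal_le_mul_le`).

The largest singular value is the first Ky Fan norm. For `k ≥ 2`, `s_k` is a difference of two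
consecutive Ky Fan norms, and a union bound finishes the proof. -/

/-! ### Infimum convolution with a quadratic cost -/

section InfimumConvolution

variable {E : Type*} [NormedAddCommGroup E]

/-- The infimum convolution of `f` with the quadratic cost `‖x - y‖ ^ 2 / (4 * D ^ 2)`. -/
noncomputable def infConv (D : ℝ) (f : E → ℝ) (x : E) : ℝ :=
  ⨅ y, (f y + ‖x - y‖ ^ 2 / (4 * D ^ 2))

variable {D : ℝ} {f g : E → ℝ} {K : NNReal}

lemma mul_le_sq_add_sq_div (hD : 0 < D) (K r : ℝ) :
    K * r ≤ K ^ 2 * D ^ 2 + r ^ 2 / (4 * D ^ 2) := by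
  have h : 0 ≤ (K * D - r / (2 * D)) ^ 2 := sq_nonneg _
  have e : (K * D - r / (2 * D)) ^ 2 = K ^ 2 * D ^ 2 + r ^ 2 / (4 * D ^ 2) - K * r := by
    field_simp; ring
  linarith

lemma LipschitzWith.le_add_mul_norm (hf : LipschitzWith K f) (x y : E) :
    f x ≤ f y + K * ‖x - y‖ := by
  have := hf.dist_le_mul x y
  rw [Real.dist_eq, dist_eq_norm] at this
  linarith [le_abs_self (f x - f y)]

lemma LipschitzWith.of_le_add_mul_norm (h : ∀ x y, f x ≤ f y + K * ‖x - y‖) :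
    LipschitzWith K f :=
  LipschitzWith.of_le_add_mul K fun x y => by simpa [dist_eq_norm] using h x y

lemma LipschitzWith.sub_le_infConv_term (hD : 0 < D) (hf : LipschitzWith K f) (x y : E) :
    f x - K ^ 2 * D ^ 2 ≤ f y + ‖x - y‖ ^ 2 / (4 * D ^ 2) := by
  have h1 := hf.le_add_mul_norm x y
  have h2 := mul_le_sq_add_sq_div hD K ‖x - y‖
  linarith

/-- Quadratic cost beats linear decrease. This keeps `⨅` a genuine infimum rather than the default
value `0`. -/
lemma LipschitzWith.bddBelow_infConv (hD : 0 < D) (hf : LipschitzWith K f) (x : E) :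
    BddBelow (Set.range fun y => f y + ‖x - y‖ ^ 2 / (4 * D ^ 2)) :=
  ⟨f x - K ^ 2 * D ^ 2, by rintro _ ⟨y, rfl⟩; exact hf.sub_le_infConv_term hD x y⟩

lemma infConv_le (hD : 0 < D) (hf : LipschitzWith K f) (x y : E) :
    infConv D f x ≤ f y + ‖x - y‖ ^ 2 / (4 * D ^ 2) :=
  ciInf_le (hf.bddBelow_infConv hD x) y

lemma le_infConv {c : ℝ} {x : E} (h : ∀ y, c ≤ f y + ‖x - y‖ ^ 2 / (4 * D ^ 2)) :
    c ≤ infConv D f x :=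
  le_ciInf h

lemma lipschitzWith_infConv (hD : 0 < D) (hf : LipschitzWith K f) :
    LipschitzWith K (infConv D f) := by
  refine LipschitzWith.of_le_add_mul_norm fun x x' => ?_
  rw [← sub_le_iff_le_add]
  refine le_infConv fun y => ?_
  -- Translating the competitor along with the base point leaves the cost unchanged.
  have h1 := infConv_le hD hf x (y + (x - x'))
  have h2 := hf.le_add_mul_norm (y + (x - x')) y
  rw [add_sub_cancel_left] at h2
  rw [show x - (y + (x - x')) = x' - y by abel] at h1
  linarith

lemma infConv_le_add (hD : 0 < D) (hg : LipschitzWith K g) {δ : ℝ} (h : ∀ y, g y ≤ f y + δ)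
    (x : E) : infConv D g x ≤ infConv D f x + δ := by
  rw [← sub_le_iff_le_add]
  refine le_infConv fun y => ?_
  linarith [infConv_le hD hg x y, h y]

lemma norm_combo_sq_le [NormedSpace ℝ E] {a b : ℝ} (ha : 0 ≤ a) (hb : 0 ≤ b) (hab : a + b = 1)
    (x y : E) : ‖a • x + b • y‖ ^ 2 ≤ a * ‖x‖ ^ 2 + b * ‖y‖ ^ 2 := by
  have h1 : ‖a • x + b • y‖ ≤ a * ‖x‖ + b * ‖y‖ := by
    refine (norm_add_le _ _).trans ?_
    rw [norm_smul, norm_smul, Real.norm_of_nonneg ha, Real.norm_of_nonneg hb]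
  have h2 : (a * ‖x‖ + b * ‖y‖) ^ 2 ≤ a * ‖x‖ ^ 2 + b * ‖y‖ ^ 2 := by
    obtain rfl : b = 1 - a := by linarith
    nlinarith [mul_nonneg (mul_nonneg ha hb) (sq_nonneg (‖x‖ - ‖y‖))]
  exact (pow_le_pow_left₀ (norm_nonneg _) h1 2).trans h2

lemma infConv_combo_le [NormedSpace ℝ E] (hD : 0 < D) {g₁ g₂ : E → ℝ} (hg : LipschitzWith K g)
    {a b : ℝ} (ha : 0 ≤ a) (hb : 0 ≤ b) (hab : a + b = 1)
    (h : ∀ y₁ y₂, g (a • y₁ + b • y₂) ≤ a * g₁ y₁ + b * g₂ y₂) (x : E) :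
    infConv D g x ≤ a * infConv D g₁ x + b * infConv D g₂ x := by
  have key : ∀ y₁ y₂, infConv D g x ≤ a * (g₁ y₁ + ‖x - y₁‖ ^ 2 / (4 * D ^ 2)) +
      b * (g₂ y₂ + ‖x - y₂‖ ^ 2 / (4 * D ^ 2)) := by
    intro y₁ y₂
    have h1 := infConv_le hD hg x (a • y₁ + b • y₂)
    have h2 : x - (a • y₁ + b • y₂) = a • (x - y₁) + b • (x - y₂) := by
      conv_lhs => rw [← one_smul ℝ x, ← hab]
      module
    have h3 := norm_combo_sq_le ha hb hab (x - y₁) (x - y₂)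
    rw [h2] at h1
    have h4 := div_le_div_of_nonneg_right h3 (by positivity : (0 : ℝ) ≤ 4 * D ^ 2)
    rw [add_div, mul_div_assoc, mul_div_assoc] at h4
    linarith [h y₁ y₂]
  refine le_of_forall_pos_le_add fun ε hε => ?_
  obtain ⟨y₁, hy₁⟩ := exists_lt_of_ciInf_lt (lt_add_of_pos_right (infConv D g₁ x) hε)
  obtain ⟨y₂, hy₂⟩ := exists_lt_of_ciInf_lt (lt_add_of_pos_right (infConv D g₂ x) hε)
  refine (key y₁ y₂).trans ?_
  have := mul_le_mul_of_nonneg_left hy₁.le ha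
  have := mul_le_mul_of_nonneg_left hy₂.le hb
  have : a * ε + b * ε = ε := by rw [← add_mul, hab, one_mul]
  linarith

end InfimumConvolution

/-! ### Property (τ): diameter-bounded measures and concentration -/

section Maurey

lemma LipschitzWith.integrable_exp {E : Type*} [NormedAddCommGroup E] [MeasurableSpace E]
    [BorelSpace E] {ν : Measure E} [IsFiniteMeasure ν]
    (hν : ∃ R : ℝ, ∀ᵐ x ∂ν, ‖x‖ ≤ R) {h : E → ℝ} {K : NNReal} (hh : LipschitzWith K h) :
    Integrable (fun x => Real.exp (h x)) ν := by
  obtain ⟨R, hR⟩ := hν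
  refine Integrable.of_bound (C := Real.exp (h 0 + K * R))
    (Real.continuous_exp.comp hh.continuous).aestronglyMeasurable ?_
  filter_upwards [hR] with x hx
  rw [Real.norm_of_nonneg (Real.exp_pos _).le, Real.exp_le_exp]
  have := hh.le_add_mul_norm x 0
  rw [sub_zero] at this
  have := mul_le_mul_of_nonneg_left hx K.coe_nonneg
  linarith

variable {E : Type*} [NormedAddCommGroup E] [NormedSpace ℝ E] [MeasurableSpace E] [BorelSpace E]

/-- Maurey's property `(τ)` for convex functions, with the quadratic cost
`‖x - y‖ ^ 2 / (4 * D ^ 2)`, for a boundedly supported measure. -/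
structure MaureyProperty (ν : Measure E) (D : ℝ) : Prop where
  ae_bounded : ∃ R : ℝ, ∀ᵐ x ∂ν, ‖x‖ ≤ R
  integral_mul_integral_le : ∀ (f : E → ℝ) (K : NNReal), ConvexOn ℝ Set.univ f →
    LipschitzWith K f → (∫ x, Real.exp (infConv D f x) ∂ν) * (∫ x, Real.exp (-f x) ∂ν) ≤ 1

/-- Both sides agree to second order at `0`, so the Taylor bounds must control the cubic terms. -/
lemma exp_sub_sq_add_exp_neg_le {u : ℝ} (h0 : 0 ≤ u) (h1 : u ≤ 1 / 2) :
    Real.exp (u - u ^ 2) ≤ 2 - Real.exp (-u) := by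
  have hv0 : 0 ≤ u - u ^ 2 := by nlinarith
  have hv1 : u - u ^ 2 ≤ 1 := by nlinarith
  have a := Real.exp_bound' hv0 hv1 (n := 3) (by norm_num)
  have b : Real.exp (-u) ≤ 1 - u + u ^ 2 / 2 := by
    have h := Real.quadratic_le_exp_of_nonneg h0
    rw [Real.exp_neg, inv_le_iff_one_le_mul₀ (Real.exp_pos _)]
    have h2 : 0 ≤ 1 - u + u ^ 2 / 2 := by nlinarith
    nlinarith [mul_le_mul_of_nonneg_left h h2, sq_nonneg (u ^ 2)]
  norm_num [Finset.sum_range_succ, Nat.factorial] at a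
  have hv3 : (u - u ^ 2) ^ 3 ≤ u ^ 3 := pow_le_pow_left₀ hv0 (by nlinarith) 3
  nlinarith [pow_nonneg h0 3, mul_nonneg (pow_nonneg h0 3) (sub_nonneg.2 h1)]

lemma exists_interpolation_exp_le {d : ℝ} (hd : 0 ≤ d) :
    ∃ l ∈ Set.Icc (0 : ℝ) 1, Real.exp ((1 - l) * d + l ^ 2 / 4) ≤ 2 - Real.exp (-d) := by
  rcases le_total d (1 / 2) with h | h
  · refine ⟨2 * d, ⟨by linarith, by linarith⟩, ?_⟩
    rw [show (1 - 2 * d) * d + (2 * d) ^ 2 / 4 = d - d ^ 2 by ring]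
    exact exp_sub_sq_add_exp_neg_le hd h
  · refine ⟨1, ⟨zero_le_one, le_rfl⟩, ?_⟩
    have h1 := exp_sub_sq_add_exp_neg_le (u := 1 / 2) (by norm_num) le_rfl
    have h2 : Real.exp (-d) ≤ Real.exp (-(1 / 2)) := Real.exp_le_exp.2 (by linarith)
    rw [show (1 - 1) * d + (1 : ℝ) ^ 2 / 4 = 1 / 2 - (1 / 2) ^ 2 by ring]
    linarith

/-- Moving a fraction `l` of the way from `x` to a near-minimizer of `f` on `S` costs at most `l ^ 2
/ 4`, while convexity gains about `l * (f x - m)`. The best `l` gives a pointwise bound affine in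
`exp (-f x)`, which can be integrated. -/
lemma maureyProperty_of_ediam_le {ν : Measure E} [IsProbabilityMeasure ν] {D : ℝ} (hD : 0 < D)
    {S : Set E} (hS : Metric.ediam S ≤ ENNReal.ofReal D) (hν : ∀ᵐ x ∂ν, x ∈ S) :
    MaureyProperty ν D := by
  obtain ⟨x₀, hx₀⟩ := hν.exists
  have hdist : ∀ x ∈ S, ∀ y ∈ S, ‖x - y‖ ≤ D := fun x hx y hy => by
    rw [← dist_eq_norm, ← ENNReal.ofReal_le_ofReal_iff hD.le, ← edist_dist]
    exact (Metric.edist_le_ediam_of_mem hx hy).trans hS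
  have hbd : ∃ R : ℝ, ∀ᵐ x ∂ν, ‖x‖ ≤ R := by
    refine ⟨D + ‖x₀‖, ?_⟩
    filter_upwards [hν] with x hx
    have := norm_le_norm_sub_add x x₀
    linarith [hdist x hx x₀ hx₀]
  refine ⟨hbd, fun f K hc hf => ?_⟩
  have hbelow : BddBelow (f '' S) := by
    refine ⟨f x₀ - K * D, ?_⟩
    rintro _ ⟨x, hx, rfl⟩
    have h1 := hf.le_add_mul_norm x₀ x
    have h2 := mul_le_mul_of_nonneg_left (hdist x₀ hx₀ x hx) K.coe_nonneg
    linarith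
  set m := sInf (f '' S) with hm
  have hpt : ∀ x ∈ S, Real.exp (infConv D f x) ≤
      Real.exp m * (2 - Real.exp m * Real.exp (-f x)) := by
    intro x hx
    have hmx : m ≤ f x := csInf_le hbelow ⟨x, hx, rfl⟩
    obtain ⟨l, ⟨hl0, hl1⟩, hl⟩ := exists_interpolation_exp_le (sub_nonneg.2 hmx)
    have hQ : ∀ y ∈ S, infConv D f x ≤ (1 - l) * f x + l * f y + l ^ 2 / 4 := by
      intro y hy
      have h1 := infConv_le hD hf x ((1 - l) • x + l • y)
      have h2 := hc.2 (Set.mem_univ x) (Set.mem_univ y) (sub_nonneg.2 hl1) hl0 (by ring)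
      have h3 : x - ((1 - l) • x + l • y) = l • (x - y) := by module
      rw [h3, norm_smul, Real.norm_of_nonneg hl0] at h1
      have h4 : (l * ‖x - y‖) ^ 2 / (4 * D ^ 2) ≤ l ^ 2 / 4 := by
        rw [div_le_div_iff₀ (by positivity) (by norm_num), mul_pow]
        have := pow_le_pow_left₀ (norm_nonneg _) (hdist x hx y hy) 2
        nlinarith [mul_le_mul_of_nonneg_left this (sq_nonneg l)]
      simp only [smul_eq_mul] at h2
      linarith
    have hQm : infConv D f x ≤ (1 - l) * f x + l * m + l ^ 2 / 4 := by
      refine le_of_forall_pos_le_add fun ε hε => ?_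
      obtain ⟨_, ⟨y, hy, rfl⟩, hy'⟩ := exists_lt_of_csInf_lt (Set.Nonempty.image f ⟨x, hx⟩)
        (lt_add_of_pos_right (sInf (f '' S)) hε)
      have h1 := hQ y hy
      have h2 := mul_le_mul_of_nonneg_left hy'.le hl0
      have h3 := mul_le_mul_of_nonneg_right hl1 hε.le
      rw [← hm] at h2
      linarith
    calc Real.exp (infConv D f x) ≤ Real.exp (m + ((1 - l) * (f x - m) + l ^ 2 / 4)) :=
          Real.exp_le_exp.2 (by linarith)
      _ = Real.exp m * Real.exp ((1 - l) * (f x - m) + l ^ 2 / 4) := Real.exp_add _ _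
      _ ≤ Real.exp m * (2 - Real.exp (-(f x - m))) :=
          mul_le_mul_of_nonneg_left hl (Real.exp_pos _).le
      _ = _ := by rw [show -(f x - m) = m + -f x by ring, Real.exp_add]
  have hi1 := (lipschitzWith_infConv hD hf).integrable_exp hbd
  have hi2 : Integrable (fun x => Real.exp (-f x)) ν := hf.neg.integrable_exp hbd
  have hle : ∫ x, Real.exp (infConv D f x) ∂ν ≤
      Real.exp m * (2 - Real.exp m * ∫ x, Real.exp (-f x) ∂ν) := by
    calc ∫ x, Real.exp (infConv D f x) ∂ν
        ≤ ∫ x, Real.exp m * (2 - Real.exp m * Real.exp (-f x)) ∂ν :=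
          integral_mono_ae hi1 (((integrable_const _).sub (hi2.const_mul _)).const_mul _)
            (hν.mono hpt)
      _ = _ := by
        rw [integral_const_mul, integral_sub (integrable_const _) (hi2.const_mul _),
          integral_const_mul]
        simp
  have hB : 0 ≤ ∫ x, Real.exp (-f x) ∂ν := integral_nonneg fun x => (Real.exp_pos _).le
  have := mul_le_mul_of_nonneg_right hle hB
  -- With `B = exp m * ∫ exp (-f)`, the product is at most `B * (2 - B) ≤ 1`.
  nlinarith [sq_nonneg (Real.exp m * (∫ x, Real.exp (-f x) ∂ν) - 1)]

lemma MaureyProperty.measureReal_le_mul_le {ν : Measure E} [IsProbabilityMeasure ν] {D : ℝ}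
    (hν : MaureyProperty ν D) (hD : 0 < D) {F : E → ℝ} {K : NNReal} (hK : 0 < K)
    (hc : ConvexOn ℝ Set.univ F) (hF : LipschitzWith K F) (a : ℝ) {t : ℝ} (ht : 0 ≤ t) :
    ν.real {x | F x ≤ a} * ν.real {x | a + t ≤ F x} ≤
      Real.exp (-(t ^ 2 / (4 * D ^ 2 * K ^ 2))) := by
  have hK' : (0 : ℝ) < K := hK
  -- This slope maximizes `l * t - l ^ 2 * K ^ 2 * D ^ 2`, the lower bound for the infimum
  -- convolution of `f` on `{a + t ≤ F}`.
  set l : NNReal := ⟨t / (2 * D ^ 2 * K ^ 2), by positivity⟩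
  set f : E → ℝ := fun x => l * max (F x - a) 0 with hf
  have hfc : ConvexOn ℝ Set.univ f :=
    ((hc.sub (concaveOn_const a convex_univ)).sup (convexOn_const 0 convex_univ)).smul l.2
  have hfl : LipschitzWith (l * K) f := by
    refine LipschitzWith.of_le_add_mul_norm fun x y => ?_
    have h1 := hF.le_add_mul_norm x y
    have h2 : max (F x - a) 0 ≤ max (F y - a) 0 + K * ‖x - y‖ := by
      have : 0 ≤ K * ‖x - y‖ := by positivity
      refine max_le ?_ ?_
      · linarith [le_max_left (F y - a) 0]
      · linarith [le_max_right (F y - a) 0]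
    have h3 := mul_le_mul_of_nonneg_left h2 l.2
    simp only [hf, NNReal.coe_mul]
    rw [mul_assoc, ← mul_add]
    exact h3
  have hi1 := (lipschitzWith_infConv hD hfl).integrable_exp hν.ae_bounded
  have hi2 : Integrable (fun x => Real.exp (-f x)) ν := hfl.neg.integrable_exp hν.ae_bounded
  have h1 : ν.real {x | F x ≤ a} ≤ ∫ x, Real.exp (-f x) ∂ν := by
    have := mul_meas_ge_le_integral_of_nonneg
      (Filter.Eventually.of_forall fun x => (Real.exp_pos (-f x)).le) hi2 1
    rw [one_mul] at this
    refine le_trans (measureReal_mono fun x hx => ?_) this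
    have : max (F x - a) 0 = 0 := max_eq_right (sub_nonpos.2 hx)
    simp [hf, this]
  have h2 : Real.exp (t ^ 2 / (4 * D ^ 2 * K ^ 2)) * ν.real {x | a + t ≤ F x} ≤
      ∫ x, Real.exp (infConv D f x) ∂ν := by
    have := mul_meas_ge_le_integral_of_nonneg
      (Filter.Eventually.of_forall fun x => (Real.exp_pos (infConv D f x)).le) hi1
      (Real.exp (t ^ 2 / (4 * D ^ 2 * K ^ 2)))
    refine le_trans (mul_le_mul_of_nonneg_left (measureReal_mono fun x hx => ?_)
      (Real.exp_pos _).le) this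
    refine Real.exp_le_exp.2 (le_infConv fun y => ?_)
    have h3 := hF.le_add_mul_norm x y
    have h4 : t - K * ‖x - y‖ ≤ max (F y - a) 0 := by
      refine le_trans ?_ (le_max_left _ _)
      linarith [show a + t ≤ F x from hx]
    have h5 : (l : ℝ) * (t - K * ‖x - y‖) ≤ f y := mul_le_mul_of_nonneg_left h4 l.2
    have h6 : (l : ℝ) * (t - K * ‖x - y‖) + ‖x - y‖ ^ 2 / (4 * D ^ 2) =
        t ^ 2 / (4 * D ^ 2 * K ^ 2) + (t - K * ‖x - y‖) ^ 2 / (4 * D ^ 2 * K ^ 2) := by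
      rw [show (l : ℝ) = t / (2 * D ^ 2 * K ^ 2) from rfl]
      field_simp
      ring
    have h7 : 0 ≤ (t - K * ‖x - y‖) ^ 2 / (4 * D ^ 2 * K ^ 2) := by positivity
    linarith
  have h3 := hν.integral_mul_integral_le f _ hfc hfl
  have h4 : (Real.exp (t ^ 2 / (4 * D ^ 2 * K ^ 2)) * ν.real {x | a + t ≤ F x}) *
      ν.real {x | F x ≤ a} ≤ 1 :=
    (mul_le_mul h2 h1 measureReal_nonneg (integral_nonneg fun x => (Real.exp_pos _).le)).trans h3
  rw [Real.exp_neg, ← one_div, le_div_iff₀ (Real.exp_pos _)]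
  linarith

end Maurey

/-! ### Products and linear contractions -/

section Tensorization

variable {E₁ E₂ E₃ : Type*}
  [NormedAddCommGroup E₁] [NormedSpace ℝ E₁] [MeasurableSpace E₁] [BorelSpace E₁]
  [NormedAddCommGroup E₂] [NormedSpace ℝ E₂] [MeasurableSpace E₂] [BorelSpace E₂]
  [NormedAddCommGroup E₃] [NormedSpace ℝ E₃] [MeasurableSpace E₃] [BorelSpace E₃]

/-- Hölder's inequality: normalize both integrals to `1` and use convexity of `exp` pointwise. -/
lemma log_integral_exp_combo_le {α : Type*} [MeasurableSpace α] {ν : Measure α}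
    [IsProbabilityMeasure ν] {G H J : α → ℝ} {a b : ℝ} (ha : 0 ≤ a) (hb : 0 ≤ b) (hab : a + b = 1)
    (hG : Integrable (fun x => Real.exp (G x)) ν) (hH : Integrable (fun x => Real.exp (H x)) ν)
    (hJ : Integrable (fun x => Real.exp (J x)) ν) (h : ∀ x, J x ≤ a * G x + b * H x) :
    Real.log (∫ x, Real.exp (J x) ∂ν) ≤
      a * Real.log (∫ x, Real.exp (G x) ∂ν) + b * Real.log (∫ x, Real.exp (H x) ∂ν) := by
  have hpG := integral_exp_pos hG
  have hpH := integral_exp_pos hH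
  rw [Real.log_le_iff_le_exp (integral_exp_pos hJ)]
  set p := Real.log (∫ x, Real.exp (G x) ∂ν) with hp
  set q := Real.log (∫ x, Real.exp (H x) ∂ν) with hq
  have hep : Real.exp (-p) * ∫ x, Real.exp (G x) ∂ν = 1 := by
    rw [hp, Real.exp_neg, Real.exp_log hpG, inv_mul_cancel₀ hpG.ne']
  have heq : Real.exp (-q) * ∫ x, Real.exp (H x) ∂ν = 1 := by
    rw [hq, Real.exp_neg, Real.exp_log hpH, inv_mul_cancel₀ hpH.ne']
  have hpt : ∀ x, Real.exp (J x) ≤ Real.exp (a * p + b * q) *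
      (a * (Real.exp (-p) * Real.exp (G x)) + b * (Real.exp (-q) * Real.exp (H x))) := by
    intro x
    have h1 := convexOn_exp.2 (Set.mem_univ (-p + G x)) (Set.mem_univ (-q + H x)) ha hb hab
    simp only [smul_eq_mul] at h1
    rw [← Real.exp_add (-p), ← Real.exp_add (-q)]
    calc Real.exp (J x) ≤ Real.exp (a * p + b * q + (a * (-p + G x) + b * (-q + H x))) :=
          Real.exp_le_exp.2 (by linarith [h x])
      _ ≤ _ := by
        rw [Real.exp_add]
        exact mul_le_mul_of_nonneg_left h1 (Real.exp_pos _).le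
  calc ∫ x, Real.exp (J x) ∂ν ≤ ∫ x, Real.exp (a * p + b * q) *
      (a * (Real.exp (-p) * Real.exp (G x)) + b * (Real.exp (-q) * Real.exp (H x))) ∂ν :=
        integral_mono hJ ((((hG.const_mul _).const_mul _).add
          ((hH.const_mul _).const_mul _)).const_mul _) hpt
    _ = Real.exp (a * p + b * q) := by
      rw [integral_const_mul, integral_add ((hG.const_mul _).const_mul _)
        ((hH.const_mul _).const_mul _), integral_const_mul, integral_const_mul,
        integral_const_mul, integral_const_mul, hep, heq, mul_one, mul_one, hab, mul_one]

lemma log_integral_exp_le_add {α : Type*} [MeasurableSpace α] {ν : Measure α}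
    [IsProbabilityMeasure ν] {G H : α → ℝ} {δ : ℝ}
    (hG : Integrable (fun x => Real.exp (G x)) ν) (hH : Integrable (fun x => Real.exp (H x)) ν)
    (h : ∀ x, G x ≤ H x + δ) :
    Real.log (∫ x, Real.exp (G x) ∂ν) ≤ Real.log (∫ x, Real.exp (H x) ∂ν) + δ := by
  rw [Real.log_le_iff_le_exp (integral_exp_pos hG), Real.exp_add,
    Real.exp_log (integral_exp_pos hH), ← integral_mul_const]
  refine integral_mono hG (hH.mul_const _) fun x => ?_
  simp only
  rw [← Real.exp_add]
  exact Real.exp_le_exp.2 (h x)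

/-- Tensorization of Maurey's property, combined with its stability under linear contractions. -/
lemma MaureyProperty.map_prod [SecondCountableTopology E₁] [SecondCountableTopology E₂]
    {ν₁ : Measure E₁} {ν₂ : Measure E₂} [IsProbabilityMeasure ν₁] [IsProbabilityMeasure ν₂]
    {D : ℝ} (hD : 0 < D) (h₁ : MaureyProperty ν₁ D) (h₂ : MaureyProperty ν₂ D)
    (L : E₁ × E₂ →ₗ[ℝ] E₃) (hL : ∀ u v, ‖L (u, v)‖ ^ 2 ≤ ‖u‖ ^ 2 + ‖v‖ ^ 2) :
    MaureyProperty ((ν₁.prod ν₂).map L) D := by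
  have hL1 : ∀ u, ‖L (u, 0)‖ ≤ ‖u‖ := fun u =>
    le_of_sq_le_sq (by simpa using hL u 0) (norm_nonneg _)
  have hL2 : ∀ v, ‖L (0, v)‖ ≤ ‖v‖ := fun v =>
    le_of_sq_le_sq (by simpa using hL 0 v) (norm_nonneg _)
  have hLadd : ∀ u v, ‖L (u, v)‖ ≤ ‖u‖ + ‖v‖ := fun u v => by
    have : L (u, v) = L (u, 0) + L (0, v) := by rw [← map_add]; simp
    rw [this]
    exact (norm_add_le _ _).trans (add_le_add (hL1 u) (hL2 v))
  -- The product carries the sup norm, hence the constant `2`; it serves only measurability and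
  -- integrability.
  have hLlip : LipschitzWith 2 L := by
    refine LipschitzWith.of_dist_le_mul fun p q => ?_
    rw [dist_eq_norm, dist_eq_norm, ← map_sub]
    refine (hLadd (p - q).1 (p - q).2).trans ?_
    have := norm_fst_le (p - q)
    have := norm_snd_le (p - q)
    push_cast
    linarith
  have hLmeas : Measurable L := hLlip.continuous.measurable
  obtain ⟨R₁, hR₁⟩ := h₁.ae_bounded
  obtain ⟨R₂, hR₂⟩ := h₂.ae_bounded
  have hR₁' : ∀ᵐ p ∂(ν₁.prod ν₂), ‖p.1‖ ≤ R₁ := Measure.quasiMeasurePreserving_fst.ae hR₁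
  have hR₂' : ∀ᵐ p ∂(ν₁.prod ν₂), ‖p.2‖ ≤ R₂ := Measure.quasiMeasurePreserving_snd.ae hR₂
  have hbd : ∃ R : ℝ, ∀ᵐ p ∂(ν₁.prod ν₂), ‖p‖ ≤ R := by
    refine ⟨max R₁ R₂, ?_⟩
    filter_upwards [hR₁', hR₂'] with p hp1 hp2
    exact max_le_max hp1 hp2
  have hbd' : ∃ R : ℝ, ∀ᵐ x ∂((ν₁.prod ν₂).map L), ‖x‖ ≤ R := by
    refine ⟨R₁ + R₂, ?_⟩
    rw [ae_map_iff hLmeas.aemeasurable (measurableSet_le measurable_norm measurable_const)]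
    filter_upwards [hR₁', hR₂'] with p hp1 hp2
    exact (hLadd p.1 p.2).trans (add_le_add hp1 hp2)
  refine ⟨hbd', fun f K hc hf => ?_⟩
  set g : E₂ → E₁ → ℝ := fun v u => f (L (u, v)) with hg
  have hgl : ∀ v, LipschitzWith K (g v) := fun v => by
    refine LipschitzWith.of_le_add_mul_norm fun x y => (hf.le_add_mul_norm _ (L (y, v))).trans ?_
    rw [← map_sub, Prod.mk_sub_mk, sub_self]
    gcongr
    exact hL1 _
  have hgv : ∀ v v' u, g v u ≤ g v' u + K * ‖v - v'‖ := fun v v' u => by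
    refine (hf.le_add_mul_norm _ (L (u, v'))).trans ?_
    rw [← map_sub, Prod.mk_sub_mk, sub_self]
    gcongr
    exact hL2 _
  have hgc : ∀ v, ConvexOn ℝ Set.univ (g v) := fun v => by
    refine ⟨convex_univ, fun x _ y _ a b ha hb hab => ?_⟩
    have := hc.2 (Set.mem_univ (L (x, v))) (Set.mem_univ (L (y, v))) ha hb hab
    rwa [← map_smul, ← map_smul, ← map_add, Prod.smul_mk, Prod.smul_mk, Prod.mk_add_mk,
      ← add_smul, hab, one_smul] at this
  have hGl := fun v => lipschitzWith_infConv hD (hgl v)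
  have hGi := fun v => (hGl v).integrable_exp h₁.ae_bounded
  set φ : E₂ → ℝ := fun v => Real.log (∫ u, Real.exp (infConv D (g v) u) ∂ν₁) with hφ
  have hexpφ : ∀ v, Real.exp (φ v) = ∫ u, Real.exp (infConv D (g v) u) ∂ν₁ := fun v =>
    Real.exp_log (integral_exp_pos (hGi v))
  -- Joint convexity of `f ∘ L` survives partial infimum convolution and then, by Hölder, the
  -- log-integral, so (τ) for `ν₂` applies to `φ`.
  have hφc : ConvexOn ℝ Set.univ φ := by
    refine ⟨convex_univ, fun v _ w _ a b ha hb hab => ?_⟩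
    refine log_integral_exp_combo_le ha hb hab (hGi v) (hGi w) (hGi _) fun u => ?_
    refine infConv_combo_le hD (hgl _) ha hb hab (fun y₁ y₂ => ?_) u
    have := hc.2 (Set.mem_univ (L (y₁, v))) (Set.mem_univ (L (y₂, w))) ha hb hab
    rwa [← map_smul, ← map_smul, ← map_add, Prod.smul_mk, Prod.smul_mk, Prod.mk_add_mk] at this
  have hφl : LipschitzWith K φ := by
    refine LipschitzWith.of_le_add_mul_norm fun v w => ?_
    exact log_integral_exp_le_add (hGi v) (hGi w) fun u =>
      infConv_le_add hD (hgl v) (hgv v w) u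
  have hQl := lipschitzWith_infConv hD hf
  have hQi : Integrable (fun p => Real.exp (infConv D f (L p))) (ν₁.prod ν₂) :=
    (hQl.comp hLlip).integrable_exp hbd
  have hfi : Integrable (fun p => Real.exp (-f (L p))) (ν₁.prod ν₂) :=
    (hf.comp hLlip).neg.integrable_exp hbd
  have hQv : ∀ v, Integrable (fun u => Real.exp (infConv D f (L (u, v)))) ν₁ := fun v => by
    refine LipschitzWith.integrable_exp h₁.ae_bounded
      (h := fun u => infConv D f (L (u, v))) (K := K) ?_
    refine LipschitzWith.of_le_add_mul_norm fun x y => (hQl.le_add_mul_norm _ (L (y, v))).trans ?_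
    rw [← map_sub, Prod.mk_sub_mk, sub_self]
    gcongr
    exact hL1 _
  -- By `hL` the cost splits: minimize over the first variable, integrate it out, then minimize over
  -- `v'`.
  have hA : ∫ x, Real.exp (infConv D f x) ∂((ν₁.prod ν₂).map L) ≤
      ∫ v, Real.exp (infConv D φ v) ∂ν₂ := by
    rw [integral_map (f := fun x => Real.exp (infConv D f x)) hLmeas.aemeasurable
      (Real.continuous_exp.comp hQl.continuous).aestronglyMeasurable, integral_prod_symm _ hQi]
    refine integral_mono hQi.integral_prod_right
      ((lipschitzWith_infConv hD hφl).integrable_exp h₂.ae_bounded) fun v => ?_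
    simp only
    rw [← Real.log_le_iff_le_exp (integral_exp_pos (hQv v))]
    refine le_infConv fun v' => log_integral_exp_le_add (hQv v) (hGi v') fun u => ?_
    rw [← sub_le_iff_le_add]
    refine le_infConv fun u' => ?_
    have h1 := infConv_le hD hf (L (u, v)) (L (u', v'))
    rw [← map_sub, Prod.mk_sub_mk] at h1
    have h2 := div_le_div_of_nonneg_right (hL (u - u') (v - v'))
      (by positivity : (0 : ℝ) ≤ 4 * D ^ 2)
    rw [add_div] at h2
    simp only [hg]
    linarith
  have hB : ∫ x, Real.exp (-f x) ∂((ν₁.prod ν₂).map L) ≤ ∫ v, Real.exp (-φ v) ∂ν₂ := by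
    rw [integral_map (f := fun x => Real.exp (-f x)) hLmeas.aemeasurable
      (Real.continuous_exp.comp hf.neg.continuous).aestronglyMeasurable, integral_prod_symm _ hfi]
    refine integral_mono hfi.integral_prod_right
      (hφl.neg.integrable_exp h₂.ae_bounded) fun v => ?_
    simp only
    have h := h₁.integral_mul_integral_le (g v) K (hgc v) (hgl v)
    rw [← hexpφ] at h
    rw [Real.exp_neg, ← one_div, le_div_iff₀ (Real.exp_pos _), mul_comm]
    exact h
  exact (mul_le_mul hA hB (integral_nonneg fun x => (Real.exp_pos _).le)
    (integral_nonneg fun x => (Real.exp_pos _).le)).trans (h₂.integral_mul_integral_le φ K hφc hφl)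

end Tensorization

/-! ### Variational principle for Ky Fan norms -/

section KyFan

variable {E F : Type*} [NormedAddCommGroup E] [InnerProductSpace ℂ E]
  [NormedAddCommGroup F] [InnerProductSpace ℂ F] {ι κ : Type*} [Fintype ι] [Fintype κ]

/-- A finite family satisfying Bessel's inequality. -/
def IsBesselFamily (u : ι → E) : Prop :=
  ∀ y, ∑ i, ‖inner ℂ (u i) y‖ ^ 2 ≤ ‖y‖ ^ 2

lemma IsBesselFamily.norm_le_one {u : ι → E} (hu : IsBesselFamily u) (i : ι) : ‖u i‖ ≤ 1 := by
  have h1 : ‖inner ℂ (u i) (u i)‖ ^ 2 ≤ ‖u i‖ ^ 2 :=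
    (Finset.single_le_sum (f := fun j => ‖inner ℂ (u j) (u i)‖ ^ 2) (fun j _ => sq_nonneg _)
      (Finset.mem_univ i)).trans (hu (u i))
  rw [inner_self_eq_norm_sq_to_K, norm_pow, RCLike.norm_ofReal, abs_norm] at h1
  by_contra! h
  nlinarith [sq_nonneg (‖u i‖ ^ 2 - 1), mul_self_nonneg (‖u i‖)]

lemma IsBesselFamily.comp_injective {u : ι → E} (hu : IsBesselFamily u) {g : κ → ι}
    (hg : Function.Injective g) : IsBesselFamily (u ∘ g) := fun y => by
  classical
  refine le_trans ?_ (hu y)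
  simp only [Function.comp_apply]
  rw [← Finset.sum_image (s := Finset.univ) (g := g) (f := fun i => ‖inner ℂ (u i) y‖ ^ 2)
    hg.injOn]
  exact Finset.sum_le_sum_of_subset_of_nonneg (Finset.subset_univ _) fun _ _ _ => sq_nonneg _

lemma isBesselFamily_of_orthonormal_subtype {u : ι → E} {p : ι → Prop} [DecidablePred p]
    (hu : Orthonormal ℂ fun i : {i // p i} => u i) (h0 : ∀ i, ¬ p i → u i = 0) :
    IsBesselFamily u := fun y => by
  have h := hu.sum_inner_products_le y (s := Finset.univ)
  refine le_trans (le_of_eq ?_) h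
  rw [← Finset.sum_filter_of_ne (p := p) (s := Finset.univ)
    (f := fun i => ‖inner ℂ (u i) y‖ ^ 2)]
  · exact Finset.sum_subtype _ (by simp) _
  · intro i _ hi
    by_contra hp
    simp [h0 i hp] at hi

lemma Orthonormal.isBesselFamily {u : ι → E} (hu : Orthonormal ℂ u) : IsBesselFamily u :=
  fun y => hu.sum_inner_products_le y (s := Finset.univ)

/-- Singular value decomposition. -/
lemma LinearMap.exists_singularValue_decomposition [FiniteDimensional ℂ E]
    [FiniteDimensional ℂ F] (T : E →ₗ[ℂ] F) {n : ℕ} (hn : Module.finrank ℂ E = n) :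
    ∃ (e : OrthonormalBasis (Fin n) ℂ E) (f : Fin n → F), IsBesselFamily f ∧
      (∀ i, T (e i) = (T.singularValues i : ℂ) • f i) ∧
      ∀ i, inner ℂ (f i) (T (e i)) = (T.singularValues i : ℂ) := by
  set e := T.isSymmetric_adjoint_comp_self.eigenvectorBasis hn with he
  have hinner : ∀ i j, inner ℂ (T (e i)) (T (e j)) =
      if i = j then (T.singularValues i : ℂ) ^ 2 else 0 := by
    intro i j
    rw [← LinearMap.adjoint_inner_right, ← LinearMap.comp_apply, he,
      LinearMap.IsSymmetric.apply_eigenvectorBasis, inner_smul_right,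
      ← T.sq_singularValues_fin hn, ← he, orthonormal_iff_ite.1 e.orthonormal]
    split_ifs with h
    · subst h; simp
    · simp
  have hnorm : ∀ i : Fin n, T.singularValues i = 0 → T (e i) = 0 := fun i hi => by
    rw [← inner_self_eq_zero (𝕜 := ℂ), hinner i i]
    simp [hi]
  -- A zero singular value gives the zero vector, as `0⁻¹ = 0`. The family is then only Bessel, but
  -- needs no completion to an orthonormal one.
  refine ⟨e, fun i => (T.singularValues i : ℂ)⁻¹ • T (e i), ?_, fun i => ?_, fun i => ?_⟩
  · refine isBesselFamily_of_orthonormal_subtype (p := fun i => T.singularValues i ≠ 0) ?_ ?_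
    · rw [orthonormal_iff_ite]
      rintro ⟨i, hi⟩ ⟨j, hj⟩
      rw [inner_smul_left, inner_smul_right, hinner]
      by_cases h : i = j
      · subst h
        simp only [if_true]
        have : (T.singularValues i : ℂ) ≠ 0 := by exact_mod_cast hi
        rw [map_inv₀, Complex.conj_ofReal]
        field_simp
      · simp [h]
    · intro i hi
      rw [not_not] at hi
      simp [hi]
  · by_cases hi : T.singularValues i = 0
    · simp only [hnorm i hi, smul_zero]
    · rw [smul_inv_smul₀]; exact_mod_cast hi
  · rw [inner_smul_left, hinner, if_pos rfl, map_inv₀, Complex.conj_ofReal]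
    by_cases hi : T.singularValues i = 0
    · simp [hi]
    · have : (T.singularValues i : ℂ) ≠ 0 := by exact_mod_cast hi
      field_simp

/-- Total weight `k` with each weight at most `1` is best spent on the first `k` terms; subtracting
the threshold `s k` makes the comparison termwise. -/
lemma sum_mul_le_sum_fin_of_antitone {s : ℕ → ℝ} (hs : Antitone s) (hs0 : ∀ i, 0 ≤ s i)
    {k n : ℕ} (hk : k ≤ n) {c : Fin n → ℝ} (hc0 : ∀ j, 0 ≤ c j) (hc1 : ∀ j, c j ≤ 1)
    (hc : ∑ j, c j ≤ k) : ∑ j : Fin n, s j * c j ≤ ∑ i ∈ Finset.range k, s i := by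
  have h1 : ∑ j : Fin n, (s j - s k) * c j ≤ ∑ i ∈ Finset.range k, (s i - s k) := by
    have h2 : ∑ i ∈ Finset.range k, (s i - s k) =
        ∑ j : Fin n, if (j : ℕ) < k then s j - s k else 0 := by
      rw [Fin.sum_univ_eq_sum_range (fun j => if j < k then s j - s k else 0), ← Finset.sum_filter]
      congr 1
      ext i
      simp only [Finset.mem_range, Finset.mem_filter]
      omega
    rw [h2]
    refine Finset.sum_le_sum fun j _ => ?_
    split_ifs with h
    · have := hs h.le
      exact mul_le_of_le_one_right (by linarith) (hc1 j)
    · have := hs (not_lt.1 h)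
      exact mul_nonpos_of_nonpos_of_nonneg (by linarith) (hc0 j)
  simp only [sub_mul, Finset.sum_sub_distrib, ← Finset.mul_sum, Finset.sum_const,
    Finset.card_range, nsmul_eq_mul] at h1
  nlinarith [mul_le_mul_of_nonneg_left hc (hs0 k)]

variable [FiniteDimensional ℂ E] [FiniteDimensional ℂ F]

/-- The Ky Fan norm of a linear map: the sum of its `k` largest singular values. -/
noncomputable def kyFan (T : E →ₗ[ℂ] F) (k : ℕ) : ℝ := ∑ i ∈ Finset.range k, T.singularValues i

/-- Expanding in the singular basis puts weight `c j` on the `j`-th singular value. AM-GM and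
Bessel, summed over either index, give `c j ≤ 1` and `∑ j, c j ≤ k`. -/
lemma re_sum_inner_le_kyFan (T : E →ₗ[ℂ] F) {k : ℕ} (hk : k ≤ Module.finrank ℂ E)
    {u : Fin k → F} {v : Fin k → E} (hu : IsBesselFamily u) (hv : IsBesselFamily v) :
    (∑ i, inner ℂ (u i) (T (v i))).re ≤ kyFan T k := by
  obtain ⟨e, f, hf, hTe, -⟩ := T.exists_singularValue_decomposition rfl
  set c : Fin (Module.finrank ℂ E) → ℝ := fun j =>
    ∑ i, ‖inner ℂ (v i) (e j)‖ * ‖inner ℂ (u i) (f j)‖ with hc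
  have hterm : ∀ i, (inner ℂ (u i) (T (v i))).re ≤
      ∑ j : Fin (Module.finrank ℂ E), T.singularValues j *
        (‖inner ℂ (v i) (e j)‖ * ‖inner ℂ (u i) (f j)‖) := by
    intro i
    refine (Complex.re_le_norm _).trans ?_
    conv_lhs => rw [← e.sum_repr' (v i), map_sum, inner_sum]
    refine (norm_sum_le _ _).trans (Finset.sum_le_sum fun j _ => le_of_eq ?_)
    rw [map_smul, hTe, inner_smul_right, inner_smul_right, norm_mul, norm_mul,
      norm_inner_symm, Complex.norm_real, Real.norm_of_nonneg (T.singularValues_nonneg _)]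
    ring
  have hsum : (∑ i, inner ℂ (u i) (T (v i))).re ≤
      ∑ j : Fin (Module.finrank ℂ E), T.singularValues j * c j := by
    rw [Complex.re_sum]
    refine (Finset.sum_le_sum fun i _ => hterm i).trans (le_of_eq ?_)
    rw [Finset.sum_comm]
    simp only [hc, Finset.mul_sum]
  have hamgm : ∀ i j, ‖inner ℂ (v i) (e j)‖ * ‖inner ℂ (u i) (f j)‖ ≤
      (‖inner ℂ (v i) (e j)‖ ^ 2 + ‖inner ℂ (u i) (f j)‖ ^ 2) / 2 := fun i j => by
    linarith [two_mul_le_add_sq ‖inner ℂ (v i) (e j)‖ ‖inner ℂ (u i) (f j)‖]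
  have sq_le_one : ∀ {r : ℝ}, 0 ≤ r → r ≤ 1 → r ^ 2 ≤ 1 := fun h0 h1 => pow_le_one₀ h0 h1
  have heB := e.orthonormal.isBesselFamily
  refine hsum.trans (sum_mul_le_sum_fin_of_antitone T.singularValues_antitone
    T.singularValues_nonneg hk (fun j => by positivity) (fun j => ?_) ?_)
  · refine (Finset.sum_le_sum fun i _ => hamgm i j).trans ?_
    rw [← Finset.sum_div, Finset.sum_add_distrib]
    have h1 := (hv (e j)).trans (sq_le_one (norm_nonneg _) (heB.norm_le_one j))
    have h2 := (hu (f j)).trans (sq_le_one (norm_nonneg _) (hf.norm_le_one j))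
    linarith
  · rw [Finset.sum_comm]
    have : ∀ i : Fin k, ∑ j, ‖inner ℂ (v i) (e j)‖ * ‖inner ℂ (u i) (f j)‖ ≤ 1 := by
      intro i
      refine (Finset.sum_le_sum fun j _ => hamgm i j).trans ?_
      rw [← Finset.sum_div, Finset.sum_add_distrib]
      have h1 := (heB (v i)).trans (sq_le_one (norm_nonneg _) (hv.norm_le_one i))
      have h2 := (hf (u i)).trans (sq_le_one (norm_nonneg _) (hu.norm_le_one i))
      simp only [norm_inner_symm (v i), norm_inner_symm (u i)]
      linarith
    refine (Finset.sum_le_sum fun i _ => this i).trans ?_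
    simp

lemma exists_re_sum_inner_eq_kyFan (T : E →ₗ[ℂ] F) {k : ℕ} (hk : k ≤ Module.finrank ℂ E) :
    ∃ (u : Fin k → F) (v : Fin k → E), IsBesselFamily u ∧ IsBesselFamily v ∧
      (∑ i, inner ℂ (u i) (T (v i))).re = kyFan T k := by
  obtain ⟨e, f, hf, -, hTe⟩ := T.exists_singularValue_decomposition rfl
  refine ⟨f ∘ Fin.castLE hk, e ∘ Fin.castLE hk, hf.comp_injective (Fin.castLE_injective hk),
    e.orthonormal.isBesselFamily.comp_injective (Fin.castLE_injective hk), ?_⟩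
  simp only [Function.comp_apply, hTe, Fin.val_castLE, kyFan]
  rw [Complex.re_sum, Fin.sum_univ_eq_sum_range (fun i => ((T.singularValues i : ℂ)).re)]
  simp

end KyFan

/-! ### Ky Fan norms as functions of the entries -/

section Frobenius

variable {m n : ℕ}

/-- The matrix with the given entries, as a linear map between Euclidean spaces. -/
noncomputable def entriesToLin :
    EuclideanSpace ℂ (Fin m × Fin n) →ₗ[ℂ]
      EuclideanSpace ℂ (Fin n) →ₗ[ℂ] EuclideanSpace ℂ (Fin m) where
  toFun x := Matrix.toEuclideanLin (Matrix.of fun j k => x (j, k))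
  map_add' x y := by rw [← map_add]; rfl
  map_smul' c x := by rw [RingHom.id_apply, ← map_smul]; rfl

lemma sum_norm_sq_entriesToLin_le {k : ℕ} {v : Fin k → EuclideanSpace ℂ (Fin n)}
    (hv : IsBesselFamily v) (x : EuclideanSpace ℂ (Fin m × Fin n)) :
    ∑ i, ‖entriesToLin x (v i)‖ ^ 2 ≤ ‖x‖ ^ 2 := by
  set r : Fin m → EuclideanSpace ℂ (Fin n) := fun j =>
    WithLp.toLp 2 fun k => starRingEnd ℂ (x (j, k)) with hr
  have h1 : ∀ i j, entriesToLin x (v i) j = inner ℂ (r j) (v i) := fun i j => by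
    simp [entriesToLin, hr, PiLp.inner_apply, Matrix.mulVec, dotProduct, mul_comm]
  simp only [EuclideanSpace.norm_sq_eq, h1]
  rw [Finset.sum_comm, Fintype.sum_prod_type]
  refine Finset.sum_le_sum fun j _ => ?_
  simp only [norm_inner_symm (r j)]
  -- Bessel is applied to each conjugated row of the matrix.
  refine (hv (r j)).trans (le_of_eq ?_)
  rw [EuclideanSpace.norm_sq_eq]
  simp [hr]

lemma re_sum_inner_entriesToLin_le {k : ℕ} {u : Fin k → EuclideanSpace ℂ (Fin m)}
    {v : Fin k → EuclideanSpace ℂ (Fin n)} (hu : IsBesselFamily u) (hv : IsBesselFamily v)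
    (x : EuclideanSpace ℂ (Fin m × Fin n)) :
    (∑ i, inner ℂ (u i) (entriesToLin x (v i))).re ≤ √k * ‖x‖ := by
  have h1 : (∑ i, inner ℂ (u i) (entriesToLin x (v i))).re ≤ ∑ i, 1 * ‖entriesToLin x (v i)‖ := by
    rw [Complex.re_sum]
    refine Finset.sum_le_sum fun i _ => (Complex.re_le_norm _).trans ?_
    refine (norm_inner_le_norm _ _).trans ?_
    exact mul_le_mul_of_nonneg_right (hu.norm_le_one i) (norm_nonneg _)
  refine (h1.trans (Real.sum_mul_le_sqrt_mul_sqrt _ _ _)).trans ?_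
  simp only [one_pow, Finset.sum_const, Finset.card_univ, Fintype.card_fin, nsmul_eq_mul, mul_one]
  refine mul_le_mul_of_nonneg_left ?_ (Real.sqrt_nonneg _)
  rw [Real.sqrt_le_left (norm_nonneg _)]
  exact sum_norm_sq_entriesToLin_le hv x

lemma lipschitzWith_kyFan {k : ℕ} (hk : k ≤ n) :
    LipschitzWith (NNReal.sqrt k)
      fun x : EuclideanSpace ℂ (Fin m × Fin n) => kyFan (entriesToLin x) k := by
  refine LipschitzWith.of_le_add_mul_norm fun x y => ?_
  have hk' : k ≤ Module.finrank ℂ (EuclideanSpace ℂ (Fin n)) := by simpa using hk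
  -- The functional optimal at `x` is also admissible at `y`.
  obtain ⟨u, v, hu, hv, h⟩ := exists_re_sum_inner_eq_kyFan (entriesToLin x) hk'
  have h1 := re_sum_inner_le_kyFan (entriesToLin y) hk' hu hv
  have h2 := re_sum_inner_entriesToLin_le hu hv (x - y)
  simp only [map_sub, LinearMap.sub_apply, inner_sub_right, Finset.sum_sub_distrib,
    Complex.sub_re] at h2
  simp only [Real.coe_sqrt, NNReal.coe_natCast]
  linarith

lemma convexOn_kyFan {k : ℕ} (hk : k ≤ n) :
    ConvexOn ℝ Set.univ
      fun x : EuclideanSpace ℂ (Fin m × Fin n) => kyFan (entriesToLin x) k := by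
  refine ⟨convex_univ, fun x _ y _ a b ha hb hab => ?_⟩
  have hk' : k ≤ Module.finrank ℂ (EuclideanSpace ℂ (Fin n)) := by simpa using hk
  obtain ⟨u, v, hu, hv, h⟩ := exists_re_sum_inner_eq_kyFan (entriesToLin (a • x + b • y)) hk'
  have h1 := mul_le_mul_of_nonneg_left (re_sum_inner_le_kyFan (entriesToLin x) hk' hu hv) ha
  have h2 := mul_le_mul_of_nonneg_left (re_sum_inner_le_kyFan (entriesToLin y) hk' hu hv) hb
  have h3 : entriesToLin (a • x + b • y) = (a : ℂ) • entriesToLin x + (b : ℂ) • entriesToLin y := by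
    rw [← map_smul, ← map_smul, ← map_add]; rfl
  simp only [h3, LinearMap.add_apply, LinearMap.smul_apply, inner_add_right, inner_smul_right,
    Finset.sum_add_distrib, ← Finset.mul_sum, Complex.add_re, Complex.re_ofReal_mul] at h
  rw [← h3] at h
  simp only [smul_eq_mul]
  linarith

end Frobenius

/-! ### Property (τ) for the law of the matrix -/

section Law

variable {Ω : Type*} [MeasurableSpace Ω] {μ : Measure Ω} [IsProbabilityMeasure μ] {D : ℝ}

lemma maureyProperty_map_toLp {ι : Type*} [Fintype ι] {X : ι → Ω → ℂ}
    (hD : 0 < D) (hX : ∀ i, Measurable (X i)) (hind : iIndepFun X μ)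
    (h : ∀ i, MaureyProperty (μ.map (X i)) D) :
    MaureyProperty (μ.map fun ω => (WithLp.toLp 2 fun i => X i ω : EuclideanSpace ℂ ι)) D := by
  classical
  -- Coordinates are switched on one at a time; `L` below overwrites coordinate `i`, so it satisfies
  -- the contraction bound.
  let Y : Finset ι → Ω → EuclideanSpace ℂ ι := fun s ω =>
    WithLp.toLp 2 fun i => if i ∈ s then X i ω else 0
  have hY : ∀ s, Measurable (Y s) := fun s => by
    refine (WithLp.measurable_toLp 2 _).comp (measurable_pi_lambda _ fun i => ?_)
    by_cases hi : i ∈ s <;> simp [hi, hX i]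
  have key : ∀ s, MaureyProperty (μ.map (Y s)) D := by
    intro s
    induction s using Finset.induction_on with
    | empty =>
      have := Measure.isProbabilityMeasure_map (μ := μ) (hY ∅).aemeasurable
      refine maureyProperty_of_ediam_le hD (S := {0}) (by simp) ?_
      refine (ae_map_iff (p := (· ∈ ({0} : Set _))) (hY ∅).aemeasurable
        (measurableSet_singleton _)).2 ?_
      filter_upwards with ω
      ext i
      simp [Y]
    | insert i s hi ih =>
      have := Measure.isProbabilityMeasure_map (μ := μ) (hY s).aemeasurable
      have := Measure.isProbabilityMeasure_map (μ := μ) (hX i).aemeasurable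
      let L : EuclideanSpace ℂ ι × ℂ →ₗ[ℝ] EuclideanSpace ℂ ι :=
        { toFun := fun p => WithLp.toLp 2 fun j => if j = i then p.2 else p.1 j
          map_add' := fun p q => by
            ext j
            by_cases hj : j = i <;> simp [hj]
          map_smul' := fun c p => by
            ext j
            by_cases hj : j = i <;> simp [hj] }
      have hL : ∀ u v, ‖L (u, v)‖ ^ 2 ≤ ‖u‖ ^ 2 + ‖v‖ ^ 2 := fun u v => by
        have hv : ‖v‖ ^ 2 = ∑ j, if j = i then ‖v‖ ^ 2 else 0 := by simp
        rw [EuclideanSpace.norm_sq_eq, EuclideanSpace.norm_sq_eq, hv, ← Finset.sum_add_distrib]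
        refine Finset.sum_le_sum fun j _ => ?_
        by_cases hj : j = i
        · simp [L, hj]
        · simp [L, hj]
      have hLm : Measurable L := by
        refine (WithLp.measurable_toLp 2 _).comp (measurable_pi_lambda _ fun j => ?_)
        by_cases hj : j = i
        · simpa [hj] using measurable_snd
        · have h1 : Measurable fun u : EuclideanSpace ℂ ι => u j :=
            (PiLp.continuous_apply 2 _ j).measurable
          simpa [hj, Function.comp_def] using h1.comp measurable_fst
      have hindep : IndepFun (Y s) (X i) μ := by
        have h1 := hind.indepFun_finset s {i} (by simpa using hi) hX
        have h2 : Measurable fun g : (s → ℂ) =>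
            (WithLp.toLp 2 fun j => if hj : j ∈ s then g ⟨j, hj⟩ else 0 : EuclideanSpace ℂ ι) := by
          refine (WithLp.measurable_toLp 2 _).comp (measurable_pi_lambda _ fun j => ?_)
          by_cases hj : j ∈ s
          · simpa [hj] using measurable_pi_apply _
          · simp [hj]
        exact h1.comp h2 (measurable_pi_apply (⟨i, by simp⟩ : ({i} : Finset ι)))
      have h3 := ih.map_prod hD (h i) L hL
      rw [← (indepFun_iff_map_prod_eq_prod_map_map (hY s).aemeasurable (hX i).aemeasurable).1
        hindep, Measure.map_map hLm ((hY s).prodMk (hX i))] at h3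
      convert h3 using 2
      ext ω j
      by_cases hj : j = i
      · subst hj; simp [Y, L]
      · simp [Y, L, hj]
  simpa [Y] using key Finset.univ

lemma SupportedInInterval.maureyProperty {y : Ω → ℝ} (hD : 0 < D) (hy : Measurable y)
    (h : SupportedInInterval y μ D) : MaureyProperty (μ.map y) D := by
  obtain ⟨a, b, hab, h⟩ := h
  have := Measure.isProbabilityMeasure_map (μ := μ) hy.aemeasurable
  refine maureyProperty_of_ediam_le hD (S := Set.Icc a b) ?_ ?_
  · rw [Real.ediam_Icc]
    exact ENNReal.ofReal_le_ofReal hab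
  · exact (ae_map_iff (p := (· ∈ Set.Icc a b)) hy.aemeasurable measurableSet_Icc).2 h

lemma BoundedEntry.maureyProperty {x : Ω → ℂ} (hD : 0 < D) (hx : Measurable x)
    (h : BoundedEntry x μ D) : MaureyProperty (μ.map x) D := by
  have := Measure.isProbabilityMeasure_map (μ := μ) hx.aemeasurable
  rcases h with ⟨S, hS, h⟩ | ⟨w, α, β, hw, hα, hβ, hind, hαD, hβD, h⟩
  -- `S` need not be measurable; its closure is, with the same diameter.
  · refine maureyProperty_of_ediam_le hD (S := closure S) (by rwa [Metric.ediam_closure]) ?_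
    refine (ae_map_iff (p := (· ∈ closure S)) hx.aemeasurable isClosed_closure.measurableSet).2 ?_
    exact h.mono fun ω hω => subset_closure hω
  · have := Measure.isProbabilityMeasure_map (μ := μ) hα.aemeasurable
    have := Measure.isProbabilityMeasure_map (μ := μ) hβ.aemeasurable
    let L : ℝ × ℝ →ₗ[ℝ] ℂ :=
      { toFun := fun p => w * ((p.1 : ℂ) + Complex.I * (p.2 : ℂ))
        map_add' := fun p q => by simp only [Prod.fst_add, Prod.snd_add]; push_cast; ring
        map_smul' := fun c p => by simp; ring }
    have hL : ∀ u v, ‖L (u, v)‖ ^ 2 ≤ ‖u‖ ^ 2 + ‖v‖ ^ 2 := fun u v => by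
      have h1 : ‖(u : ℂ) + Complex.I * (v : ℂ)‖ ^ 2 = ‖u‖ ^ 2 + ‖v‖ ^ 2 := by
        rw [← Complex.normSq_eq_norm_sq, mul_comm, Complex.normSq_add_mul_I]
        simp
      have h2 : ‖w‖ ^ 2 ≤ 1 := pow_le_one₀ (norm_nonneg _) hw
      change ‖w * ((u : ℂ) + Complex.I * (v : ℂ))‖ ^ 2 ≤ _
      rw [norm_mul, mul_pow, h1]
      exact mul_le_of_le_one_left (by positivity) h2
    have hLm : Measurable L := by
      change Measurable fun p : ℝ × ℝ => w * ((p.1 : ℂ) + Complex.I * (p.2 : ℂ))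
      fun_prop
    have h3 := (hαD.maureyProperty hD hα).map_prod hD (hβD.maureyProperty hD hβ) L hL
    rw [← (indepFun_iff_map_prod_eq_prod_map_map hα.aemeasurable hβ.aemeasurable).1 hind,
      Measure.map_map hLm (hα.prodMk hβ)] at h3
    rwa [Measure.map_congr h]

end Law

/-! ### Medians and two-sided tails -/

section Median

lemma exists_isMedian {Ω : Type*} [MeasurableSpace Ω] {μ : Measure Ω} [IsProbabilityMeasure μ]
    {Y : Ω → ℝ} (hY : Measurable Y) : ∃ M, IsMedian Y μ M := by
  have := Measure.isProbabilityMeasure_map (μ := μ) hY.aemeasurable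
  set F := cdf (μ.map Y) with hF
  set S := {x | 1 / 2 ≤ F x} with hS
  have hne : S.Nonempty :=
    (((tendsto_cdf_atTop (μ.map Y)).eventually (lt_mem_nhds (by norm_num : (1 / 2 : ℝ) < 1))).mono
      fun x hx => hx.le).exists
  obtain ⟨b, hb⟩ := ((tendsto_cdf_atBot (μ.map Y)).eventually
    (gt_mem_nhds (by norm_num : (0 : ℝ) < 1 / 2))).exists
  have hbelow : BddBelow S := ⟨b, fun x hx => by
    by_contra! hxb
    exact absurd ((F.mono hxb.le).trans_lt hb) (not_lt.2 hx)⟩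
  set M := sInf S
  have hgt : ∀ x, M < x → 1 / 2 ≤ F x := fun x hx => by
    obtain ⟨y, hy, hyx⟩ := exists_lt_of_csInf_lt hne hx
    exact le_trans hy (F.mono hyx.le)
  have hlt : ∀ x, x < M → F x ≤ 1 / 2 := fun x hx => by
    by_contra! h
    exact absurd (csInf_le hbelow (show x ∈ S from h.le)) (not_le.2 hx)
  refine ⟨M, ?_, ?_⟩
  · have h1 : 1 / 2 ≤ F M :=
      ge_of_tendsto ((F.right_continuous M).tendsto.mono_left
        (nhdsWithin_mono _ Set.Ioi_subset_Ici_self)) (by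
        filter_upwards [self_mem_nhdsWithin] with x hx using hgt x hx)
    rw [hF, cdf_eq_real, map_measureReal_apply hY measurableSet_Iic] at h1
    exact h1
  · have h1 : Function.leftLim F M ≤ 1 / 2 :=
      le_of_tendsto (F.mono.tendsto_leftLim M) (by
        filter_upwards [self_mem_nhdsWithin] with x hx using hlt x hx)
    have h2 := F.measure_Ici (tendsto_cdf_atTop (μ.map Y)) M
    rw [hF, measure_cdf, ← hF] at h2
    have h3 : (μ.map Y).real (Set.Ici M) = 1 - Function.leftLim F M := by
      rw [measureReal_def, h2, ENNReal.toReal_ofReal (by linarith)]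
    rw [map_measureReal_apply hY measurableSet_Ici] at h3
    change 1 / 2 ≤ μ.real (Y ⁻¹' Set.Ici M)
    linarith

lemma MaureyProperty.measureReal_abs_sub_median_le {Ω E : Type*} [MeasurableSpace Ω]
    {μ : Measure Ω} [IsProbabilityMeasure μ] [NormedAddCommGroup E] [NormedSpace ℝ E]
    [MeasurableSpace E] [BorelSpace E] {X : Ω → E} (hX : Measurable X) {D : ℝ} (hD : 0 < D)
    (h : MaureyProperty (μ.map X) D) {F : E → ℝ} {K : NNReal} (hK : 0 < K)
    (hc : ConvexOn ℝ Set.univ F) (hF : LipschitzWith K F) {M : ℝ}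
    (hM : IsMedian (fun ω => F (X ω)) μ M) {t : ℝ} (ht : 0 ≤ t) :
    μ.real {ω | t ≤ |F (X ω) - M|} ≤ 4 * Real.exp (-(t ^ 2 / (4 * D ^ 2 * K ^ 2))) := by
  have := Measure.isProbabilityMeasure_map (μ := μ) hX.aemeasurable
  have key : ∀ a, μ.real {ω | F (X ω) ≤ a} * μ.real {ω | a + t ≤ F (X ω)} ≤
      Real.exp (-(t ^ 2 / (4 * D ^ 2 * K ^ 2))) := fun a => by
    have h1 := h.measureReal_le_mul_le hD hK hc hF a ht
    rwa [map_measureReal_apply hX (measurableSet_le hF.continuous.measurable measurable_const),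
      map_measureReal_apply hX
        (measurableSet_le measurable_const hF.continuous.measurable)] at h1
  -- Levels `M` and `M - t` give the two tails; the median makes the other factor at least `1 / 2`,
  -- so each costs a factor `2`.
  have h1 := key M
  have h2 := key (M - t)
  rw [sub_add_cancel] at h2
  have h3 : μ.real {ω | t ≤ |F (X ω) - M|} ≤
      μ.real {ω | M + t ≤ F (X ω)} + μ.real {ω | F (X ω) ≤ M - t} := by
    refine le_trans (measureReal_mono fun ω hω => ?_) (measureReal_union_le _ _)
    rcases le_abs.1 (show t ≤ |F (X ω) - M| from hω) with h | h
    · exact Or.inl (show M + t ≤ F (X ω) by linarith)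
    · exact Or.inr (show F (X ω) ≤ M - t by linarith)
  obtain ⟨hM1, hM2⟩ := hM
  have h4 := mul_le_mul_of_nonneg_right hM1
    (measureReal_nonneg (μ := μ) (s := {ω | M + t ≤ F (X ω)}))
  have h5 := mul_le_mul_of_nonneg_left hM2
    (measureReal_nonneg (μ := μ) (s := {ω | F (X ω) ≤ M - t}))
  linarith

end Median

/-! ### Conclusion for singular values -/

lemma matrixSingularValue_eq_kyFan_sub {m n : ℕ} (A : Matrix (Fin m) (Fin n) ℂ) (k : ℕ) :
    matrixSingularValue A (k + 1) =
      kyFan (entriesToLin (WithLp.toLp 2 fun p : Fin m × Fin n => A p.1 p.2)) (k + 1) -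
      kyFan (entriesToLin (WithLp.toLp 2 fun p : Fin m × Fin n => A p.1 p.2)) k := by
  rw [kyFan, kyFan, Finset.sum_range_succ, add_sub_cancel_left]
  rfl

theorem mainTheorem5 {Ω : Type*} [MeasurableSpace Ω] (μ : Measure Ω) [IsProbabilityMeasure μ]
    (m n : ℕ) (hm : 1 ≤ m) (hn : 1 ≤ n) (D : ℝ) (hD : 0 < D)
    (X : Ω → Matrix (Fin m) (Fin n) ℂ)
    (hmeas : ∀ j k, Measurable (fun ω => X ω j k))
    (hindep : iIndepFun (fun (p : Fin m × Fin n) (ω : Ω) => X ω p.1 p.2) μ)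
    (hbdd : ∀ j k, BoundedEntry (fun ω => X ω j k) μ D) :
    (∀ M : ℝ, IsMedian (fun ω => matrixSingularValue (X ω) 1) μ M →
      ∀ t : ℝ, 0 < t →
        μ.real {ω | t ≤ |matrixSingularValue (X ω) 1 - M|} ≤
          4 * Real.exp (-(t ^ 2 / (4 * D ^ 2)))) ∧
    (∀ k : ℕ, 2 ≤ k → k ≤ min m n →
      ∃ M : ℝ, ∀ t : ℝ, 0 < t →
        μ.real {ω | t ≤ |matrixSingularValue (X ω) k - M|} ≤
          8 * Real.exp (-((t / (2 * (√(k : ℝ) + √((k : ℝ) - 1)) * D)) ^ 2)) ∧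
        8 * Real.exp (-((t / (2 * (√(k : ℝ) + √((k : ℝ) - 1)) * D)) ^ 2)) ≤
          8 * Real.exp (-(t ^ 2 / (16 * (k : ℝ) * D ^ 2)))) := by
  have hEm : Measurable fun ω => (WithLp.toLp 2 fun p : Fin m × Fin n => X ω p.1 p.2 :
      EuclideanSpace ℂ (Fin m × Fin n)) :=
    (WithLp.measurable_toLp 2 _).comp (measurable_pi_lambda _ fun p => hmeas p.1 p.2)
  have hP := maureyProperty_map_toLp hD (fun p : Fin m × Fin n => hmeas p.1 p.2) hindep
    fun p => (hbdd p.1 p.2).maureyProperty hD (hmeas p.1 p.2)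
  have hconc : ∀ k, 1 ≤ k → k ≤ n → ∀ M : ℝ,
      IsMedian (fun ω => kyFan (entriesToLin
        (WithLp.toLp 2 fun p : Fin m × Fin n => X ω p.1 p.2)) k) μ M → ∀ t : ℝ, 0 ≤ t →
      μ.real {ω | t ≤ |kyFan (entriesToLin
        (WithLp.toLp 2 fun p : Fin m × Fin n => X ω p.1 p.2)) k - M|} ≤
          4 * Real.exp (-(t ^ 2 / (4 * D ^ 2 * k))) := by
    intro k hk hkn M hM t ht
    have hK : 0 < NNReal.sqrt (k : NNReal) := NNReal.sqrt_pos.2 (by exact_mod_cast hk)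
    have h1 := hP.measureReal_abs_sub_median_le hEm hD hK (convexOn_kyFan hkn)
      (lipschitzWith_kyFan hkn) hM ht
    rwa [Real.coe_sqrt, NNReal.coe_natCast, Real.sq_sqrt (Nat.cast_nonneg k)] at h1
  have hmed : ∀ k, k ≤ n → ∃ M, IsMedian (fun ω => kyFan (entriesToLin
      (WithLp.toLp 2 fun p : Fin m × Fin n => X ω p.1 p.2)) k) μ M := fun k hkn =>
    exists_isMedian ((lipschitzWith_kyFan hkn).continuous.measurable.comp hEm)
  refine ⟨fun M hM t ht => ?_, fun k hk2 hk => ?_⟩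
  · have h0 : ∀ A : Matrix (Fin m) (Fin n) ℂ, matrixSingularValue A 1 =
        kyFan (entriesToLin (WithLp.toLp 2 fun p : Fin m × Fin n => A p.1 p.2)) 1 := fun A => by
      rw [matrixSingularValue_eq_kyFan_sub A 0]
      simp [kyFan]
    simp only [h0] at hM ⊢
    simpa using hconc 1 le_rfl hn M hM t ht.le
  · obtain ⟨k, rfl⟩ : ∃ l, k = l + 1 := ⟨k - 1, by omega⟩
    have hkn : k + 1 ≤ n := hk.trans (min_le_right _ _)
    obtain ⟨M₁, hM₁⟩ := hmed (k + 1) hkn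
    obtain ⟨M₀, hM₀⟩ := hmed k (by omega)
    have hk0 : (0 : ℝ) < k := by exact_mod_cast (show 0 < k by omega)
    have hcast : ((k + 1 : ℕ) : ℝ) - 1 = k := by push_cast; ring
    rw [hcast]
    set a := √((k + 1 : ℕ) : ℝ) with ha
    set b := √(k : ℝ) with hb
    have ha2 : a ^ 2 = ((k + 1 : ℕ) : ℝ) := Real.sq_sqrt (Nat.cast_nonneg _)
    have hb2 : b ^ 2 = k := Real.sq_sqrt hk0.le
    have hb0 : 0 < b := Real.sqrt_pos.2 hk0
    have ha0 : 0 < a := Real.sqrt_pos.2 (by positivity)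
    have hba : b ≤ a := Real.sqrt_le_sqrt (by push_cast; linarith)
    -- The center is a difference of Ky Fan medians. Splitting `t` in the ratio `a : b` of the
    -- Lipschitz constants makes both exponents equal.
    refine ⟨M₁ - M₀, fun t ht => ⟨?_, ?_⟩⟩
    · have h1 := hconc (k + 1) (by omega) hkn M₁ hM₁ (t * a / (a + b)) (by positivity)
      have h0 := hconc k (by omega) (by omega) M₀ hM₀ (t * b / (a + b)) (by positivity)
      have e1 : (t * a / (a + b)) ^ 2 / (4 * D ^ 2 * ((k + 1 : ℕ) : ℝ)) =
          (t / (2 * (a + b) * D)) ^ 2 := by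
        rw [← ha2]; field_simp; ring
      have e0 : (t * b / (a + b)) ^ 2 / (4 * D ^ 2 * (k : ℝ)) =
          (t / (2 * (a + b) * D)) ^ 2 := by
        rw [← hb2]; field_simp; ring
      rw [e1] at h1
      rw [e0] at h0
      refine le_trans ((measureReal_mono fun ω hω => ?_).trans (measureReal_union_le _ _))
        ((add_le_add h1 h0).trans (by linarith))
      rw [Set.mem_ofPred_eq, matrixSingularValue_eq_kyFan_sub, sub_sub_sub_comm] at hω
      by_contra hcon
      simp only [Set.mem_union, Set.mem_ofPred_eq, not_or, not_le] at hcon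
      have h2 : t * a / (a + b) + t * b / (a + b) = t := by field_simp
      linarith [hω.trans (abs_sub _ _)]
    · refine mul_le_mul_of_nonneg_left (Real.exp_le_exp.2 (neg_le_neg ?_)) (by norm_num)
      rw [div_pow, ← ha2]
      refine div_le_div_of_nonneg_left (sq_nonneg _) (by positivity) ?_
      rw [mul_pow, mul_pow]
      have : (a + b) ^ 2 ≤ (2 * a) ^ 2 := pow_le_pow_left₀ (by positivity) (by linarith) 2
      nlinarith [mul_le_mul_of_nonneg_right this (sq_nonneg D)]
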